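/- All graphs are finite and simple. For a graph $G$ let $Q(G)=D(G)+A(G)$ be its signless Laplacian matrix, where $D(G)$ is the diagonal matrix of vertex degrees and $A(G)$ is the adjacency matrix, and let $q(G)$ be the largest eigenvalue of $Q(G)$. Let $\delta(G)$ be the minimum degree of $G$. Let $\cup$ denote disjoint union, let $tK_1$ denote the edgeless graph on $t$ vertices, and let $G_1\vee G_2$ denote the join, obtained from $G_1\cup G_2$ by joining every vertex of $G_1$ to every vertex of $G_2$. A leaf of a tree is a vertex of degree one, and the leaf distance of a tree is the minimum distance in the tree between two distinct leaves. Theorem. Let $t\ge 1$ be an integer and let $G$ be a connected graph of order $n\ge 7t+1$ with $\delta(G)\ge t$. If $$q(G)\ \ge\ q\bigl(K_t\vee(K_{n-2t}\cup tK_1)\bigr),$$ then $G$ has a spanning tree with leaf distance at least four. -/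

import Mathlib

namespace LeafDist

/-- The join `G ∨ H` of two vertex-disjoint graphs: the disjoint union `G ∪ H`, with every vertex
of `G` joined to every vertex of `H`. -/
def join {V W : Type*} (G : SimpleGraph V) (H : SimpleGraph W) : SimpleGraph (V ⊕ W) :=
  (G ⊕g H) ⊔ completeBipartiteGraph V W

/-- The graph `K_t ∨ (K_{n-2t} ∪ tK_1)`. It is used for `2t ≤ n`, and then has `n` vertices. -/
def extremalGraph (n t : ℕ) : SimpleGraph (Fin t ⊕ (Fin (n - 2 * t) ⊕ Fin t)) :=
  join (⊤ : SimpleGraph (Fin t)) ((⊤ : SimpleGraph (Fin (n - 2 * t))) ⊕g (⊥ : SimpleGraph (Fin t)))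

open Classical in
/-- The signless Laplacian matrix `Q(G) = D(G) + A(G)`. -/
noncomputable def signlessLaplacian {V : Type*} [Fintype V] (G : SimpleGraph V) : Matrix V V ℝ :=
  G.degMatrix ℝ + G.adjMatrix ℝ

open Classical in
/-- The signless Laplacian spectral radius `q(G)`: the largest eigenvalue of `Q(G)`. -/
noncomputable def signlessRadius {V : Type*} [Fintype V] (G : SimpleGraph V) : ℝ :=
  sSup {x : ℝ | Module.End.HasEigenvalue (Matrix.toLin' (signlessLaplacian G)) x}

open Classical in
/-- On a nonempty vertex set the supremum defining `q(G)` is attained: `q(G)` is the largest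
eigenvalue. -/
theorem isGreatest_signlessRadius {V : Type*} [Fintype V] [Nonempty V] (G : SimpleGraph V) :
    IsGreatest {x : ℝ | Module.End.HasEigenvalue (Matrix.toLin' (signlessLaplacian G)) x}
      (signlessRadius G) := by
  have hset : {x : ℝ | Module.End.HasEigenvalue (Matrix.toLin' (signlessLaplacian G)) x}
      = spectrum ℝ (signlessLaplacian G) := by
    ext x
    rw [Set.mem_ofPred_eq, Module.End.hasEigenvalue_iff_mem_spectrum, Matrix.spectrum_toLin']
  have hH : (signlessLaplacian G).IsHermitian :=
    (G.isHermitian_degMatrix (R := ℝ)).add (G.isHermitian_adjMatrix (R := ℝ))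
  have hfin : (spectrum ℝ (signlessLaplacian G)).Finite := Matrix.finite_real_spectrum
  have hne : (spectrum ℝ (signlessLaplacian G)).Nonempty :=
    ⟨_, hH.eigenvalues_mem_spectrum_real (Classical.arbitrary V)⟩
  unfold signlessRadius
  rw [hset]
  exact ⟨hne.csSup_mem hfin, fun x hx => le_csSup hfin.bddAbove hx⟩

/-- A leaf is a vertex of degree one. -/
def IsLeaf {V : Type*} (T : SimpleGraph V) (v : V) : Prop :=
  (T.neighborSet v).ncard = 1

/-- The leaf distance of `T`: the minimum distance in `T` between two distinct leaves
(it is `⊤` if there are no two distinct leaves, which for a finite tree means a single vertex). -/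
noncomputable def leafDistance {V : Type*} (T : SimpleGraph V) : ℕ∞ :=
  sInf {d : ℕ∞ | ∃ u v : V, IsLeaf T u ∧ IsLeaf T v ∧ u ≠ v ∧ d = T.edist u v}

/-- `T` is a spanning tree of `G`. Being a graph on the same vertex type, `T` is spanning. -/
def IsSpanningTree {V : Type*} (G T : SimpleGraph V) : Prop :=
  T ≤ G ∧ T.IsTree

end LeafDist

/-! The spectral condition forces a Hamiltonian path, which is a spanning tree whose two leaves are
at distance `n - 1 ≥ 4`. Without such a path, Chvátal's condition
(`exists_card_degree_le_of_forall_not_isHamPath`) gives some `k` for which at least `k + 1` vertices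
have degree at most `k` and at most `k` have degree above `n - k - 2`; the minimum degree gives `k ≥
t`.

Both radii are compared with a root `l > 2n - 2t - 2` of the cubic `quotientPoly n t`. It is an
eigenvalue of the extremal graph (`le_signlessRadius_extremalGraph`), hence at most its radius.
Conversely, `quotientPoly n k l ≥ 0` for `t ≤ k ≤ n / 2` (`quotientPoly_nonneg`), so a positive
vector with three values, adapted to the degree classes, satisfies `Qx < lx` (`exists_weights`).
Thus `q(G) < l`, a contradiction. -/

namespace LeafDist

/-! ### Hamiltonian paths and Chvátal's degree condition. -/

/-- `p 0, p 1, …, p (|V| - 1)` lists the vertices of a Hamiltonian path of `G`. -/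
structure IsHamPath {V : Type*} [Fintype V] (G : SimpleGraph V) (p : ℕ → V) : Prop where
  injOn : Set.InjOn p (Set.Iio (Fintype.card V))
  adj : ∀ i, i + 1 < Fintype.card V → G.Adj (p i) (p (i + 1))

section

variable {V : Type*} [Fintype V]

theorem exists_lt_card_eq_of_injOn {p : ℕ → V} (hp : Set.InjOn p (Set.Iio (Fintype.card V)))
    (v : V) : ∃ i, i < Fintype.card V ∧ p i = v := by
  have hinj : Function.Injective (fun i : Fin (Fintype.card V) => p i) := fun i j h =>
    Fin.ext (hp i.2 j.2 h)
  obtain ⟨i, hi⟩ := ((Fintype.bijective_iff_injective_and_card _).2 ⟨hinj, by simp⟩).2 v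
  exact ⟨i, i.2, hi⟩

/-- Reversing the segment from `a` to `b`. -/
def reverseSegment (a b m : ℕ) : ℕ := if a ≤ m ∧ m ≤ b then a + b - m else m

theorem reverseSegment_injective (a b : ℕ) : Function.Injective (reverseSegment a b) := by
  intro x y h
  unfold reverseSegment at h
  split_ifs at h <;> omega

/-- Reversing a segment of a vertex ordering whose consecutive pairs, with the exception of the two
pairs at the ends of the segment, are adjacent. -/
theorem IsHamPath.reverse_segment {G : SimpleGraph V} {p : ℕ → V} {a b : ℕ}
    (hp : Set.InjOn p (Set.Iio (Fintype.card V))) (hab : a ≤ b) (hb : b < Fintype.card V)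
    (hadj : ∀ i, i + 1 < Fintype.card V → i + 1 ≠ a → i ≠ b → G.Adj (p i) (p (i + 1)))
    (hleft : ∀ i, i + 1 = a → G.Adj (p i) (p b))
    (hright : b + 1 < Fintype.card V → G.Adj (p a) (p (b + 1))) :
    IsHamPath G (p ∘ reverseSegment a b) := by
  refine ⟨?_, ?_⟩
  · refine hp.comp (reverseSegment_injective a b).injOn ?_
    intro m hm
    simp only [Set.mem_Iio] at hm ⊢
    unfold reverseSegment
    split_ifs <;> omega
  · intro i hi
    simp only [Function.comp_apply]
    unfold reverseSegment
    split_ifs with h1 h2 h2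
    · have := hadj (a + b - (i + 1)) (by omega) (by omega) (by omega)
      rw [show a + b - (i + 1) + 1 = a + b - i by omega] at this
      exact this.symm
    · obtain rfl : i = b := by omega
      simpa using hright hi
    · have hia : i + 1 = a := by omega
      rw [hia, Nat.add_sub_cancel_left]
      exact hleft i hia
    · exact hadj i hi (by omega) (by omega)

open Classical in
/-- If adding the edge `uv` to a graph without a Hamiltonian path creates one, then
`d(u) + d(v) ≤ n - 2`. -/
theorem degree_add_degree_add_two_le {H : SimpleGraph V} {p : ℕ → V} {j : ℕ}
    (hH : ∀ q, ¬ IsHamPath H q) (hp : Set.InjOn p (Set.Iio (Fintype.card V)))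
    (hj : j + 1 < Fintype.card V)
    (hadj : ∀ i, i + 1 < Fintype.card V → i ≠ j → H.Adj (p i) (p (i + 1)))
    (huv : ¬ H.Adj (p j) (p (j + 1))) :
    H.degree (p j) + H.degree (p (j + 1)) + 2 ≤ Fintype.card V := by
  set n := Fintype.card V with hn
  -- Ore's crossing argument: an index in both `X` and `Y` would let a segment reversal bypass the
  -- missing pair. Both sets also omit `j`, so their sizes add up to at most `n - 2`.
  set X := (Finset.range (n - 1)).filter fun i => H.Adj (p j) (p i)
  set Y := (Finset.range (n - 1)).filter fun i => H.Adj (p (j + 1)) (p (i + 1))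
  have hend : ¬ H.Adj (p j) (p (n - 1)) := fun h =>
    hH _ (IsHamPath.reverse_segment (a := j + 1) (b := n - 1) hp (by omega) (by omega)
      (fun i hi h1 _ => hadj i hi (by omega))
      (fun i hi => by obtain rfl : i = j := by omega
                      exact h) (fun h => by omega))
  have hstart : ¬ H.Adj (p (j + 1)) (p 0) := fun h =>
    hH _ (IsHamPath.reverse_segment (a := 0) (b := j) hp (by omega) (by omega)
      (fun i hi _ h1 => hadj i hi (by omega))
      (fun i hi => by omega) (fun _ => h.symm))
  have hX : H.degree (p j) ≤ X.card := by
    rw [← SimpleGraph.card_neighborFinset_eq_degree]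
    refine (Finset.card_le_card ?_).trans (Finset.card_image_le (f := p))
    intro w hw
    rw [SimpleGraph.mem_neighborFinset] at hw
    obtain ⟨i, hi, rfl⟩ := exists_lt_card_eq_of_injOn hp w
    have : i ≠ n - 1 := fun h => hend (h ▸ hw)
    exact Finset.mem_image_of_mem p (by simp [X, hw]; omega)
  have hY : H.degree (p (j + 1)) ≤ Y.card := by
    rw [← SimpleGraph.card_neighborFinset_eq_degree]
    refine (Finset.card_le_card ?_).trans (Finset.card_image_le (f := fun i => p (i + 1)))
    intro w hw
    rw [SimpleGraph.mem_neighborFinset] at hw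
    obtain ⟨i, hi, rfl⟩ := exists_lt_card_eq_of_injOn hp w
    have h0 : i ≠ 0 := fun h => hstart (h ▸ hw)
    obtain ⟨i, rfl⟩ := Nat.exists_eq_succ_of_ne_zero h0
    exact Finset.mem_image.2 ⟨i, by simp [Y, hw]; omega, rfl⟩
  have hXY : Disjoint X Y := by
    rw [Finset.disjoint_left]
    intro i hiX hiY
    simp only [X, Y, Finset.mem_filter, Finset.mem_range] at hiX hiY
    rcases lt_trichotomy i j with h | rfl | h
    · exact hH _ (IsHamPath.reverse_segment (a := i + 1) (b := j) hp (by omega) (by omega)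
        (fun m hm _ h1 => hadj m hm (by omega))
        (fun m hm => by obtain rfl : m = i := by omega
                        exact hiX.2.symm) (fun _ => hiY.2.symm))
    · exact H.loopless.irrefl _ hiX.2
    · exact hH _ (IsHamPath.reverse_segment (a := j + 1) (b := i) hp (by omega) (by omega)
        (fun m hm h1 _ => hadj m hm (by omega))
        (fun m hm => by obtain rfl : m = j := by omega
                        exact hiX.2) (fun _ => hiY.2))
  have hsub : X ∪ Y ⊆ (Finset.range (n - 1)).erase j := by
    intro i hi
    rw [Finset.mem_union] at hi
    simp only [X, Y, Finset.mem_filter, Finset.mem_range] at hi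
    rw [Finset.mem_erase, Finset.mem_range]
    refine ⟨?_, by tauto⟩
    rintro rfl
    rcases hi with hi | hi <;> exact H.loopless.irrefl _ hi.2
  have hcard := Finset.card_le_card hsub
  rw [Finset.card_union_of_disjoint hXY, Finset.card_erase_of_mem (by simp; omega),
    Finset.card_range] at hcard
  omega

-- By maximality, adding `uv` creates a Hamiltonian path; injectivity of the ordering makes it use
-- `uv` only once, so all its other steps lie in `H`.
open Classical in
theorem degree_add_degree_add_two_le_of_maximal {H : SimpleGraph V}
    (hH : Maximal (fun K : SimpleGraph V => ∀ q, ¬ IsHamPath K q) H) {u v : V} (hne : u ≠ v)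
    (huv : ¬ H.Adj u v) : H.degree u + H.degree v + 2 ≤ Fintype.card V := by
  have hlt : H < H ⊔ SimpleGraph.edge u v := SimpleGraph.lt_sup_edge _ _ _ hne huv
  have hnot := hH.not_prop_of_gt hlt
  push Not at hnot
  obtain ⟨p, hp, hadj⟩ := hnot
  have hex : ∃ j, j + 1 < Fintype.card V ∧ ¬ H.Adj (p j) (p (j + 1)) := by
    by_contra hcon
    push Not at hcon
    exact hH.prop p ⟨hp, hcon⟩
  obtain ⟨j, hj, hjadj⟩ := hex
  have hedge : ∀ i, i + 1 < Fintype.card V → ¬ H.Adj (p i) (p (i + 1)) →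
      (p i = u ∧ p (i + 1) = v) ∨ (p i = v ∧ p (i + 1) = u) := by
    intro i hi hn
    have := hadj i hi
    rw [SimpleGraph.sup_adj, SimpleGraph.edge_adj] at this
    tauto
  have hinj : ∀ a b, a < Fintype.card V → b < Fintype.card V → p a = p b → a = b :=
    fun a b ha hb h => hp ha hb h
  have hrest : ∀ i, i + 1 < Fintype.card V → i ≠ j → H.Adj (p i) (p (i + 1)) := by
    intro i hi hij
    by_contra hn
    rcases hedge i hi hn with ⟨h1, h2⟩ | ⟨h1, h2⟩ <;>
      rcases hedge j hj hjadj with ⟨h3, h4⟩ | ⟨h3, h4⟩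
    · exact hij (hinj _ _ (by omega) (by omega) (h1.trans h3.symm))
    · have := hinj _ _ (by omega) (by omega) (h1.trans h4.symm)
      have := hinj _ _ (by omega) (by omega) (h2.trans h3.symm)
      omega
    · have := hinj _ _ (by omega) (by omega) (h1.trans h4.symm)
      have := hinj _ _ (by omega) (by omega) (h2.trans h3.symm)
      omega
    · exact hij (hinj _ _ (by omega) (by omega) (h1.trans h3.symm))
  have hsum := degree_add_degree_add_two_le hH.prop hp hj hrest hjadj
  rcases hedge j hj hjadj with ⟨h3, h4⟩ | ⟨h3, h4⟩ <;> rw [h3, h4] at hsum <;> omega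

theorem exists_isHamPath_top [Nonempty V] : ∃ p, IsHamPath (⊤ : SimpleGraph V) p := by
  have e := (Fintype.equivFin V).symm
  have hinj : Set.InjOn (fun i => if h : i < Fintype.card V then e ⟨i, h⟩ else Classical.arbitrary V)
      (Set.Iio (Fintype.card V)) := by
    intro i hi j hj h
    rw [Set.mem_Iio] at hi hj
    simpa [hi, hj] using h
  refine ⟨_, hinj, fun i hi => ?_⟩
  rw [SimpleGraph.top_adj]
  intro h
  have := hinj (Set.mem_Iio.2 (by omega)) (Set.mem_Iio.2 hi) h
  omega

open Classical in
/-- **Chvátal's degree condition** for Hamiltonian paths. -/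
theorem exists_card_degree_le_of_forall_not_isHamPath [Nonempty V] {G : SimpleGraph V}
    (hG : ∀ p, ¬ IsHamPath G p) :
    ∃ k, 2 * k + 2 ≤ Fintype.card V ∧
      k + 1 ≤ (Finset.univ.filter fun v => G.degree v ≤ k).card ∧
      (Finset.univ.filter fun v => Fintype.card V < G.degree v + k + 2).card ≤ k := by
  obtain ⟨H, hGH, hH⟩ :=
    Finite.exists_le_maximal (p := fun K : SimpleGraph V => ∀ q, ¬ IsHamPath K q) hG
  have hdeg : ∀ v, G.degree v ≤ H.degree v := fun v => SimpleGraph.degree_le_of_le hGH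
  set P := (Finset.univ : Finset (V × V)).filter fun e => e.1 ≠ e.2 ∧ ¬ H.Adj e.1 e.2 with hP
  have hPne : P.Nonempty := by
    by_contra hemp
    rw [Finset.not_nonempty_iff_eq_empty] at hemp
    obtain ⟨p, hp⟩ := exists_isHamPath_top (V := V)
    refine hH.prop p ⟨hp.injOn, fun i hi => ?_⟩
    by_contra hn
    have : (p i, p (i + 1)) ∈ P := by
      simp only [hP, Finset.mem_filter, Finset.mem_univ, true_and]
      exact ⟨(hp.adj i hi).ne, hn⟩
    simp [hemp] at this
  -- An extremal nonadjacent pair, ordered so that `u` has the smaller degree, yields `k = H.degree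
  -- u`. Non-neighbours of `v` then have degree at most `k`, and every vertex of degree above `n - k
  -- - 2` must be a neighbour of `u`.
  obtain ⟨e, heP, hmax⟩ := Finset.exists_max_image P (fun e => H.degree e.1 + H.degree e.2) hPne
  obtain ⟨u, v, huv, hnadj, hmax, hle⟩ : ∃ u v, u ≠ v ∧ ¬ H.Adj u v ∧
      (∀ x y, x ≠ y → ¬ H.Adj x y → H.degree x + H.degree y ≤ H.degree u + H.degree v) ∧
      H.degree u ≤ H.degree v := by
    simp only [hP, Finset.mem_filter, Finset.mem_univ, true_and, and_imp, Prod.forall] at heP hmax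
    rcases le_total (H.degree e.1) (H.degree e.2) with h | h
    · exact ⟨e.1, e.2, heP.1, heP.2, hmax, h⟩
    · exact ⟨e.2, e.1, heP.1.symm, fun h => heP.2 h.symm,
        fun x y h1 h2 => (hmax x y h1 h2).trans_eq (add_comm _ _), h⟩
  have hsum := degree_add_degree_add_two_le_of_maximal hH huv hnadj
  refine ⟨H.degree u, by omega, ?_, ?_⟩
  · have hsub : Hᶜ.neighborFinset v ⊆ Finset.univ.filter fun w => G.degree w ≤ H.degree u := by
      intro w hw
      rw [SimpleGraph.mem_neighborFinset, SimpleGraph.compl_adj] at hw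
      have := hmax v w hw.1 hw.2
      have := hdeg w
      simp only [Finset.mem_filter, Finset.mem_univ, true_and]
      omega
    have := Finset.card_le_card hsub
    rw [SimpleGraph.card_neighborFinset_eq_degree, SimpleGraph.degree_compl] at this
    omega
  · have hsub : (Finset.univ.filter fun w => Fintype.card V < G.degree w + H.degree u + 2) ⊆
        H.neighborFinset u := by
      intro w hw
      simp only [Finset.mem_filter, Finset.mem_univ, true_and] at hw
      have := hdeg w
      rw [SimpleGraph.mem_neighborFinset]
      by_contra hn
      by_cases huw : u = w
      · subst huw
        omega
      · have := hmax u w huw hn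
        omega
    have := Finset.card_le_card hsub
    rwa [SimpleGraph.card_neighborFinset_eq_degree] at this

/-! ### A Hamiltonian path as a spanning tree, and its leaf distance. -/

/-- The path graph on the vertex ordering `p`. -/
def pathOf (p : ℕ → V) : SimpleGraph V :=
  SimpleGraph.fromRel fun x y => ∃ i, i + 1 < Fintype.card V ∧ p i = x ∧ p (i + 1) = y

theorem pathOf_adj_iff {p : ℕ → V} (hp : Set.InjOn p (Set.Iio (Fintype.card V))) {i j : ℕ}
    (hi : i < Fintype.card V) (hj : j < Fintype.card V) :
    (pathOf p).Adj (p i) (p j) ↔ i + 1 = j ∨ j + 1 = i := by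
  have hinj : ∀ a b, a < Fintype.card V → b < Fintype.card V → (p a = p b ↔ a = b) :=
    fun a b ha hb => ⟨fun h => hp ha hb h, fun h => h ▸ rfl⟩
  rw [pathOf, SimpleGraph.fromRel_adj]
  constructor
  · rintro ⟨-, ⟨m, hm, h1, h2⟩ | ⟨m, hm, h1, h2⟩⟩
    all_goals
      rw [hinj _ _ (by omega) (by omega)] at h1 h2
      omega
  · rintro (rfl | rfl)
    · exact ⟨by rw [ne_eq, hinj _ _ hi hj]; omega, Or.inl ⟨i, hj, rfl, rfl⟩⟩
    · exact ⟨by rw [ne_eq, hinj _ _ hi hj]; omega, Or.inr ⟨j, hi, rfl, rfl⟩⟩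

theorem IsHamPath.pathOf_le {G : SimpleGraph V} {p : ℕ → V} (hp : IsHamPath G p) :
    pathOf p ≤ G := by
  intro x y h
  rw [pathOf, SimpleGraph.fromRel_adj] at h
  obtain ⟨-, ⟨i, hi, rfl, rfl⟩ | ⟨i, hi, rfl, rfl⟩⟩ := h
  · exact hp.adj i hi
  · exact (hp.adj i hi).symm

theorem pathOf_isTree [Nonempty V] {p : ℕ → V}
    (hp : Set.InjOn p (Set.Iio (Fintype.card V))) : (pathOf p).IsTree := by
  classical
  have hpos : 0 < Fintype.card V := Fintype.card_pos
  have hreach : ∀ i, i < Fintype.card V → (pathOf p).Reachable (p 0) (p i) := by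
    intro i
    induction i with
    | zero => exact fun _ => SimpleGraph.Reachable.refl _
    | succ i ih =>
      intro hi
      exact (ih (by omega)).trans
        ((pathOf_adj_iff hp (by omega) hi).2 (Or.inl rfl)).reachable
  have hconn : (pathOf p).Connected := by
    rw [SimpleGraph.connected_iff]
    refine ⟨fun x y => ?_, inferInstance⟩
    obtain ⟨i, hi, rfl⟩ := exists_lt_card_eq_of_injOn hp x
    obtain ⟨j, hj, rfl⟩ := exists_lt_card_eq_of_injOn hp y
    exact (hreach i hi).symm.trans (hreach j hj)
  rw [SimpleGraph.isTree_iff_connected_and_card]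
  refine ⟨hconn, le_antisymm ?_ hconn.card_vert_le_card_edgeSet_add_one⟩
  have hsub : (pathOf p).edgeFinset ⊆
      (Finset.range (Fintype.card V - 1)).image fun i => s(p i, p (i + 1)) := by
    intro e
    induction e with | _ x y
    intro h
    rw [SimpleGraph.mem_edgeFinset, SimpleGraph.mem_edgeSet] at h
    obtain ⟨i, hi, rfl⟩ := exists_lt_card_eq_of_injOn hp x
    obtain ⟨j, hj, rfl⟩ := exists_lt_card_eq_of_injOn hp y
    rw [Finset.mem_image]
    rcases (pathOf_adj_iff hp hi hj).1 h with rfl | rfl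
    · exact ⟨i, by simp; omega, rfl⟩
    · exact ⟨j, by simp; omega, Sym2.eq_swap⟩
  have := (Finset.card_le_card hsub).trans Finset.card_image_le
  rw [Finset.card_range] at this
  rw [Nat.card_eq_fintype_card, Nat.card_eq_fintype_card, ← SimpleGraph.edgeFinset_card]
  omega

theorem IsLeaf.index_eq {p : ℕ → V} (hp : Set.InjOn p (Set.Iio (Fintype.card V))) {i : ℕ}
    (hi : i < Fintype.card V) (hleaf : IsLeaf (pathOf p) (p i)) :
    i = 0 ∨ i + 1 = Fintype.card V := by
  by_contra hcon
  push Not at hcon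
  obtain ⟨m, rfl⟩ := Nat.exists_eq_succ_of_ne_zero hcon.1
  obtain ⟨w, hw⟩ := Set.ncard_eq_one.1 hleaf
  have h1 : p m ∈ (pathOf p).neighborSet (p (m + 1)) :=
    (pathOf_adj_iff hp hi (by omega)).2 (Or.inr rfl)
  have h2 : p (m + 1 + 1) ∈ (pathOf p).neighborSet (p (m + 1)) :=
    (pathOf_adj_iff hp hi (by omega)).2 (Or.inl rfl)
  rw [hw, Set.mem_singleton_iff] at h1 h2
  have := hp (Set.mem_Iio.2 (by omega)) (Set.mem_Iio.2 (by omega)) (h1.trans h2.symm)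
  omega

/-- Each step of a walk changes the index by exactly one, so walk length bounds index difference. -/
theorem index_le_length_add {p : ℕ → V} (hp : Set.InjOn p (Set.Iio (Fintype.card V))) {x y : V}
    (w : (pathOf p).Walk x y) :
    ∀ i j, i < Fintype.card V → j < Fintype.card V → p i = x → p j = y →
      i ≤ w.length + j ∧ j ≤ w.length + i := by
  induction w with
  | nil =>
    rintro i j hi hj rfl h
    have := hp (Set.mem_Iio.2 hj) (Set.mem_Iio.2 hi) h
    omega
  | @cons x z y h w ih =>
    rintro i j hi hj rfl hy
    obtain ⟨m, hm, rfl⟩ := exists_lt_card_eq_of_injOn hp z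
    have h1 := (pathOf_adj_iff hp hi hm).1 h
    have h2 := ih m j hm hj rfl hy
    rw [SimpleGraph.Walk.length_cons]
    omega

theorem card_sub_one_le_leafDistance_pathOf {p : ℕ → V}
    (hp : Set.InjOn p (Set.Iio (Fintype.card V))) :
    ((Fintype.card V - 1 : ℕ) : ℕ∞) ≤ leafDistance (pathOf p) := by
  refine le_sInf ?_
  rintro d ⟨x, y, hx, hy, hxy, rfl⟩
  obtain ⟨i, hi, rfl⟩ := exists_lt_card_eq_of_injOn hp x
  obtain ⟨j, hj, rfl⟩ := exists_lt_card_eq_of_injOn hp y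
  have hij : i ≠ j := fun h => hxy (h ▸ rfl)
  have h1 := hx.index_eq hp hi
  have h2 := hy.index_eq hp hj
  rw [SimpleGraph.edist_eq_sInf]
  refine le_sInf ?_
  rintro _ ⟨w, rfl⟩
  have h3 := index_le_length_add hp w i j hi hj rfl rfl
  exact Nat.cast_le.2 (by omega)

theorem IsHamPath.exists_isSpanningTree {G : SimpleGraph V} {p : ℕ → V} (hp : IsHamPath G p)
    (hcard : 5 ≤ Fintype.card V) :
    ∃ T : SimpleGraph V, IsSpanningTree G T ∧ 4 ≤ leafDistance T := by
  have : Nonempty V := Fintype.card_pos_iff.1 (by omega)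
  refine ⟨pathOf p, ⟨hp.pathOf_le, pathOf_isTree hp.injOn⟩,
    le_trans ?_ (card_sub_one_le_leafDistance_pathOf hp.injOn)⟩
  exact_mod_cast (by omega : 4 ≤ Fintype.card V - 1)

end

/-! ### The quotient cubic and the test weights. -/

/-- The characteristic polynomial, evaluated at `l`, of the quotient of the signless Laplacian of
`K_s ∨ (K_{n-2s} ∪ sK_1)` by the partition into its three parts. -/
def quotientPoly (n s l : ℝ) : ℝ :=
  (l - n - s + 2) * (l - s) * (l - 2 * n + 3 * s + 2) - (n - 2 * s) * s * (l - s)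
    - s ^ 2 * (l - 2 * n + 3 * s + 2)

/-- Intermediate values on `(2n - 2t - 2, 2n)`. The lower endpoint is the radius of the clique
`K_{n-t}` inside the extremal graph. Only some root there is needed, not the largest. -/
theorem exists_quotientPoly_eq_zero {n t : ℝ} (ht : 1 ≤ t) (hn : 7 * t + 1 ≤ n) :
    ∃ l, 2 * n - 2 * t - 2 < l ∧ quotientPoly n t l = 0 := by
  have hcont : Continuous (quotientPoly n t) := by
    unfold quotientPoly
    fun_prop
  have h1 : quotientPoly n t (2 * n - 2 * t - 2) < 0 := by
    have : quotientPoly n t (2 * n - 2 * t - 2) = -(t ^ 2 * (2 * n - 3 * t - 2) + t ^ 3) := by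
      unfold quotientPoly
      ring
    rw [this, neg_lt_zero]
    have : 0 < 2 * n - 3 * t - 2 := by linarith
    positivity
  have h2 : 0 < quotientPoly n t (2 * n) := by
    obtain ⟨m, rfl⟩ : ∃ m, n = 7 * t + 1 + m := ⟨n - (7 * t + 1), by ring⟩
    have hm : 0 ≤ m := by linarith
    have : quotientPoly (7 * t + 1 + m) t (2 * (7 * t + 1 + m)) =
        (6 * t + 3 + m) * (13 * t + 2 + 2 * m) * (3 * t + 2)
          - (5 * t + 1 + m) * t * (13 * t + 2 + 2 * m) - t ^ 2 * (3 * t + 2) := by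
      unfold quotientPoly
      ring
    rw [this]
    ring_nf
    positivity
  obtain ⟨l, hl, hl0⟩ := intermediate_value_Ioo (by linarith) hcont.continuousOn ⟨h1, h2⟩
  exact ⟨l, hl.1, hl0⟩

/-- As a function of `k` this is a cubic with leading coefficient `-2`, vanishing at `t`. A
nonnegative slope at `t` and a nonnegative value at `n / 2` keep it nonnegative in between. -/
theorem quotientPoly_nonneg {n t k l : ℝ} (ht : 1 ≤ t) (hn : 7 * t + 1 ≤ n)
    (hl : 2 * n - 2 * t - 2 ≤ l) (hroot : quotientPoly n t l = 0) (htk : t ≤ k)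
    (hk : 2 * k ≤ n) : 0 ≤ quotientPoly n k l := by
  set p₁ := 3 * (l + 2 - n) * l - (l + 2 - 2 * n) * (2 * l + 2 - n) - n * l with hp₁
  set p₂ := -3 * (l + 2 - n) - l + n with hp₂
  -- The derivative in `k` at `k = t`.
  have hslope : 0 ≤ p₁ + 2 * p₂ * t - 6 * t ^ 2 := by
    obtain ⟨m, rfl⟩ : ∃ m, n = 7 * t + 1 + m := ⟨n - (7 * t + 1), by ring⟩
    obtain ⟨e, rfl⟩ : ∃ e, l = 2 * (7 * t + 1 + m) - 2 * t - 2 + e :=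
      ⟨l - (2 * (7 * t + 1 + m) - 2 * t - 2), by ring⟩
    have hm : 0 ≤ m := by linarith
    have he : 0 ≤ e := by linarith
    rw [hp₁, hp₂]
    ring_nf
    nlinarith [mul_nonneg hm he, mul_nonneg hm (by linarith : 0 ≤ t),
      mul_nonneg he (by linarith : 0 ≤ t), mul_nonneg hm hm, mul_nonneg he he]
  have hhalf : 0 ≤ quotientPoly n (n / 2) l := by
    have heq : quotientPoly n (n / 2) l =
        (l - n / 2 + 2) * ((l - 3 * n / 2 + 2) * (l - n / 2) - n ^ 2 / 4) := by
      unfold quotientPoly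
      ring
    rw [heq]
    refine mul_nonneg (by linarith) ?_
    obtain ⟨m, rfl⟩ : ∃ m, n = 7 * t + 1 + m := ⟨n - (7 * t + 1), by ring⟩
    obtain ⟨e, rfl⟩ : ∃ e, l = 2 * (7 * t + 1 + m) - 2 * t - 2 + e :=
      ⟨l - (2 * (7 * t + 1 + m) - 2 * t - 2), by ring⟩
    have hm : 0 ≤ m := by linarith
    have he : 0 ≤ e := by linarith
    nlinarith [mul_nonneg hm he, mul_nonneg hm (by linarith : 0 ≤ t),
      mul_nonneg he (by linarith : 0 ≤ t), mul_nonneg hm hm, mul_nonneg he he]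
  -- Hermite interpolation with a double node at `t` and a simple node at `n / 2`; the last term in
  -- the bracket comes from the leading coefficient.
  have hinterp : (n / 2 - t) ^ 2 * quotientPoly n k l =
      (k - t) * ((n / 2 - t) * (p₁ + 2 * p₂ * t - 6 * t ^ 2) * (n / 2 - k)
        + quotientPoly n (n / 2) l * (k - t) + 2 * (k - t) * (n / 2 - k) * (n / 2 - t) ^ 2)
      + ((n / 2 - t) ^ 2 - (k - t) ^ 2) * quotientPoly n t l := by
    rw [hp₁, hp₂]
    unfold quotientPoly
    ring
  have hd : 0 < n / 2 - t := by linarith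
  have h1 : 0 ≤ k - t := by linarith
  have h2 : 0 ≤ n / 2 - k := by linarith
  rw [hroot, mul_zero, add_zero] at hinterp
  refine nonneg_of_mul_nonneg_right (a := (n / 2 - t) ^ 2) ?_ (by positivity)
  rw [hinterp]
  positivity

/-- Weights for the test vector bounding the signless Laplacian radius of a graph in which at most
`k` vertices have degree above `n - k - 2` and at least `k + 1` have degree at most `k`. -/
theorem exists_weights {n t k l : ℝ} (ht : 1 ≤ t) (hn : 7 * t + 1 ≤ n)
    (hl : 2 * n - 2 * t - 2 < l) (hroot : quotientPoly n t l = 0) (htk : t ≤ k)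
    (hk : 2 * k + 2 ≤ n) :
    ∃ b c : ℝ, 0 < c ∧ c ≤ b ∧ b ≤ 1 ∧ k * c + k < l * c ∧
      2 * (n - k - 2) * b + k * (1 - b) < l * b ∧
      (n - 2) + n * b + k * (1 - b) - (k + 1) * (b - c) < l := by
  have hP := quotientPoly_nonneg ht hn hl.le hroot htk (by linarith)
  have hC : 0 < l - 2 * n + 3 * k + 2 := by linarith
  have hB : 0 < l - k := by linarith
  have hk0 : 0 < k := by linarith
  -- `b` and `c₀` solve the clique and independent-set rows of the quotient eigenvalue equation with
  -- value 1 on the `k` join vertices. The remaining row becomes the inequality `hS`.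
  set b := k / (l - 2 * n + 3 * k + 2) with hb
  set c₀ := k / (l - k) with hc₀
  have hbe : b * (l - 2 * n + 3 * k + 2) = k := div_mul_cancel₀ _ hC.ne'
  have hce : c₀ * (l - k) = k := div_mul_cancel₀ _ hB.ne'
  have hb0 : 0 < b := by positivity
  have hc0 : 0 < c₀ := by positivity
  have hcb : c₀ < b := div_lt_div_of_pos_left hk0 hC (by linarith)
  have hb1 : b ≤ 1 := (div_le_one hC).2 (by linarith)
  have hS : n + k - 2 + (n - 2 * k) * b + k * c₀ ≤ l := by
    have : quotientPoly n k l =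
        (l - (n + k - 2 + (n - 2 * k) * b + k * c₀)) * ((l - k) * (l - 2 * n + 3 * k + 2)) := by
      unfold quotientPoly
      linear_combination (n - 2 * k) * (l - k) * hbe + k * (l - 2 * n + 3 * k + 2) * hce
    rw [this] at hP
    have := nonneg_of_mul_nonneg_left hP (by positivity)
    linarith
  -- Having `k + 1` low-degree vertices instead of `k` leaves slack `b - c₀` in the last inequality.
  -- Raising `c₀` by `ε` costs only `(k + 1) * ε` of it and makes the low-degree row strict.
  set ε := (b - c₀) / (k + 2) with hε
  have hεe : ε * (k + 2) = b - c₀ := div_mul_cancel₀ _ (by linarith)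
  have hε0 : 0 < ε := div_pos (by linarith) (by linarith)
  refine ⟨b, c₀ + ε, by positivity, ?_, hb1, ?_, ?_, ?_⟩
  · nlinarith
  · nlinarith
  · nlinarith
  · nlinarith

/-! ### Bounds on the signless Laplacian radius. -/

section

variable {V : Type*} [Fintype V]

open Classical in
theorem signlessLaplacian_mulVec_apply (G : SimpleGraph V) (x : V → ℝ) (v : V) :
    (signlessLaplacian G).mulVec x v = G.degree v * x v + ∑ u ∈ G.neighborFinset v, x u := by
  rw [signlessLaplacian, Matrix.add_mulVec, Pi.add_apply, SimpleGraph.degMatrix_mulVec_apply,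
    SimpleGraph.adjMatrix_mulVec_apply]

open Classical in
theorem signlessLaplacian_mulVec_apply_eq_sum_ite (G : SimpleGraph V) (x : V → ℝ) (v : V) :
    (signlessLaplacian G).mulVec x v = ∑ u, if G.Adj v u then x v + x u else 0 := by
  rw [signlessLaplacian_mulVec_apply, ← Finset.sum_filter, Finset.sum_add_distrib,
    ← SimpleGraph.neighborFinset_eq_filter, Finset.sum_const, nsmul_eq_mul,
    SimpleGraph.card_neighborFinset_eq_degree]

/-- An eigenvalue with a nonzero eigenvector is at most the signless Laplacian radius. -/
theorem le_signlessRadius {G : SimpleGraph V} {l : ℝ} {x : V → ℝ} (hx : x ≠ 0)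
    (h : (signlessLaplacian G).mulVec x = l • x) : l ≤ signlessRadius G := by
  classical
  obtain ⟨v, -⟩ := Function.ne_iff.1 hx
  have : Nonempty V := ⟨v⟩
  refine (isGreatest_signlessRadius G).2 ?_
  exact Module.End.hasEigenvalue_of_hasEigenvector
    ⟨Module.End.mem_eigenspace_iff.2 (by simpa using h), hx⟩

open Classical in
/-- A positive vector with `Qx < lx` entrywise certifies that the signless Laplacian radius is less
than `l`. -/
theorem signlessRadius_lt [Nonempty V] {G : SimpleGraph V} {l : ℝ} {x : V → ℝ}
    (hx : ∀ v, 0 < x v)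
    (h : ∀ v, G.degree v * x v + ∑ u ∈ G.neighborFinset v, x u < l * x v) :
    signlessRadius G < l := by
  obtain ⟨y, hy, hy0⟩ := (isGreatest_signlessRadius G).1.exists_hasEigenvector
  rw [Module.End.mem_eigenspace_iff, Matrix.toLin'_apply] at hy
  -- At a vertex maximizing `|y v| / x v`, the eigenvector is compared with the multiple of `x` that
  -- dominates it and touches it there.
  obtain ⟨v, -, hv⟩ := Finset.exists_max_image Finset.univ (fun v => |y v| / x v)
    Finset.univ_nonempty
  set r := |y v| / x v with hr
  have hle : ∀ u, |y u| ≤ r * x u := fun u => (div_le_iff₀ (hx u)).1 (hv u (Finset.mem_univ u))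
  have hyv : |y v| = r * x v := (div_mul_cancel₀ _ (hx v).ne').symm
  have hr0 : 0 < r := by
    obtain ⟨u, hu⟩ := Function.ne_iff.1 hy0
    have : 0 < |y u| := abs_pos.2 hu
    exact pos_of_mul_pos_left (this.trans_le (hle u)) (hx u).le
  have hval : signlessRadius G * y v =
      G.degree v * y v + ∑ u ∈ G.neighborFinset v, y u := by
    rw [← signlessLaplacian_mulVec_apply, hy, Pi.smul_apply, smul_eq_mul]
  have hkey : signlessRadius G * |y v| < l * |y v| := by
    calc signlessRadius G * |y v| ≤ |signlessRadius G * y v| := by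
          rw [abs_mul]
          exact mul_le_mul_of_nonneg_right (le_abs_self _) (abs_nonneg _)
      _ ≤ G.degree v * |y v| + ∑ u ∈ G.neighborFinset v, |y u| := by
          rw [hval]
          refine (abs_add_le _ _).trans (add_le_add ?_ (Finset.abs_sum_le_sum_abs _ _))
          rw [abs_mul, Nat.abs_cast]
      _ ≤ G.degree v * (r * x v) + ∑ u ∈ G.neighborFinset v, r * x u := by
          rw [hyv]
          exact add_le_add le_rfl (Finset.sum_le_sum fun u _ => hle u)
      _ = r * (G.degree v * x v + ∑ u ∈ G.neighborFinset v, x u) := by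
          rw [← Finset.mul_sum]
          ring
      _ < r * (l * x v) := mul_lt_mul_of_pos_left (h v) hr0
      _ = l * |y v| := by rw [hyv]; ring
  exact lt_of_mul_lt_mul_right hkey (abs_nonneg _)

open Classical in
theorem signlessRadius_lt_of_card_degree_le {G : SimpleGraph V} {t k : ℕ} {l : ℝ} (ht : 1 ≤ t)
    (hn : 7 * t + 1 ≤ Fintype.card V) (hl : 2 * (Fintype.card V : ℝ) - 2 * t - 2 < l)
    (hroot : quotientPoly (Fintype.card V) t l = 0) (htk : t ≤ k)
    (hk : 2 * k + 2 ≤ Fintype.card V)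
    (hlow : k + 1 ≤ (Finset.univ.filter fun v => G.degree v ≤ k).card)
    (hhigh : (Finset.univ.filter fun v => Fintype.card V < G.degree v + k + 2).card ≤ k) :
    signlessRadius G < l := by
  have : Nonempty V := Fintype.card_pos_iff.1 (by omega)
  have hnR : 7 * (t : ℝ) + 1 ≤ Fintype.card V := by exact_mod_cast hn
  have hkR : 2 * (k : ℝ) + 2 ≤ Fintype.card V := by exact_mod_cast hk
  obtain ⟨b, c, hc0, hcb, hb1, hI, hM, hS⟩ :=
    exists_weights (by exact_mod_cast ht) hnR hl hroot (by exact_mod_cast htk) hkR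
  set n := Fintype.card V with hndef
  set S := Finset.univ.filter fun v => n < G.degree v + k + 2 with hSdef
  set I := Finset.univ.filter fun v => G.degree v ≤ k with hIdef
  have hlowR : (k : ℝ) + 1 ≤ I.card := by exact_mod_cast hlow
  have hhighR : (S.card : ℝ) ≤ k := by exact_mod_cast hhigh
  -- Weight 1 on high-degree vertices, `c` on low-degree ones, `b` elsewhere, written additively so
  -- that sums split into cardinalities.
  set x : V → ℝ := fun v =>
    b + (if v ∈ S then 1 - b else 0) - (if v ∈ I then b - c else 0) with hx
  have hdisj : ∀ v, v ∈ S → v ∉ I := by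
    intro v h1 h2
    simp only [hSdef, hIdef, Finset.mem_filter, Finset.mem_univ, true_and] at h1 h2
    omega
  have hxS : ∀ v, v ∈ S → x v = 1 := fun v h => by simp [hx, h, hdisj v h]
  have hxI : ∀ v, v ∈ I → x v = c := fun v h => by
    simp [hx, h, show v ∉ S from fun h' => hdisj v h' h]
  have hxM : ∀ v, v ∉ S → v ∉ I → x v = b := fun v h h' => by simp [hx, h, h']
  have hx1 : ∀ v, x v ≤ 1 := by
    intro v
    by_cases h1 : v ∈ S
    · exact (hxS v h1).le
    by_cases h2 : v ∈ I
    · rw [hxI v h2]; linarith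
    · rw [hxM v h1 h2]; linarith
  have hxb : ∀ v, x v ≤ b + if v ∈ S then 1 - b else 0 := by
    intro v
    simp only [hx]
    split_ifs <;> linarith
  have hsum_le : ∀ N : Finset V, ∑ u ∈ N, x u ≤ N.card * b + k * (1 - b) := by
    intro N
    calc ∑ u ∈ N, x u ≤ ∑ u ∈ N, (b + if u ∈ S then 1 - b else 0) :=
          Finset.sum_le_sum fun u _ => hxb u
      _ = N.card * b + (N ∩ S).card * (1 - b) := by
          rw [Finset.sum_add_distrib, Finset.sum_ite_mem]
          simp only [Finset.sum_const, nsmul_eq_mul]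
      _ ≤ N.card * b + k * (1 - b) := by
          have : ((N ∩ S).card : ℝ) ≤ k :=
            (Nat.cast_le.2 (Finset.card_le_card Finset.inter_subset_right)).trans hhighR
          have := mul_le_mul_of_nonneg_right this (sub_nonneg.2 hb1)
          linarith
  have hsum_univ : ∑ u, x u = n * b + S.card * (1 - b) - I.card * (b - c) := by
    simp only [hx]
    rw [Finset.sum_sub_distrib, Finset.sum_add_distrib, Finset.sum_ite_mem, Finset.sum_ite_mem]
    simp only [Finset.sum_const, nsmul_eq_mul, Finset.univ_inter, Finset.card_univ, ← hndef]
  have hx0 : ∀ v, 0 < x v := by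
    intro v
    by_cases h1 : v ∈ S
    · rw [hxS v h1]; exact one_pos
    by_cases h2 : v ∈ I
    · rwa [hxI v h2]
    · rw [hxM v h1 h2]; linarith
  refine signlessRadius_lt hx0 fun v => ?_
  · have hcardN : ((G.neighborFinset v).card : ℝ) = G.degree v := by
      rw [SimpleGraph.card_neighborFinset_eq_degree]
    by_cases h1 : v ∈ S
    · have hdeg : (G.degree v : ℝ) ≤ n - 1 := by
        have := G.degree_lt_card_verts v
        have : (G.degree v : ℝ) + 1 ≤ n := by exact_mod_cast this
        linarith
      have hN : ∑ u ∈ G.neighborFinset v, x u ≤ ∑ u, x u - x v := by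
        rw [le_sub_iff_add_le, add_comm, ← Finset.sum_insert (by simp)]
        refine Finset.sum_le_sum_of_subset_of_nonneg (Finset.subset_univ _) fun u _ _ => ?_
        exact (hx0 u).le
      rw [hsum_univ] at hN
      rw [hxS v h1] at hN ⊢
      have h3 := mul_le_mul_of_nonneg_right hhighR (sub_nonneg.2 hb1)
      have h4 := mul_le_mul_of_nonneg_right hlowR (sub_nonneg.2 hcb)
      linarith
    by_cases h2 : v ∈ I
    · have hdeg : (G.degree v : ℝ) ≤ k := by
        simp only [hIdef, Finset.mem_filter, Finset.mem_univ, true_and] at h2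
        exact_mod_cast h2
      have hN := Finset.sum_le_card_nsmul (G.neighborFinset v) x 1 fun u _ => hx1 u
      rw [nsmul_eq_mul, mul_one, hcardN] at hN
      rw [hxI v h2]
      have := mul_le_mul_of_nonneg_right hdeg hc0.le
      linarith
    · have hdeg : (G.degree v : ℝ) ≤ n - k - 2 := by
        simp only [hSdef, Finset.mem_filter, Finset.mem_univ, true_and, not_lt] at h1
        have : (G.degree v : ℝ) + k + 2 ≤ n := by exact_mod_cast h1
        linarith
      have hN := hsum_le (G.neighborFinset v)
      rw [hcardN] at hN
      rw [hxM v h1 h2]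
      have := mul_le_mul_of_nonneg_right hdeg (hc0.le.trans hcb)
      linarith

end

/-! ### The extremal graph has `l` as an eigenvalue. -/

theorem le_signlessRadius_extremalGraph {n t : ℕ} {l : ℝ} (ht : 1 ≤ t) (hn : 7 * t + 1 ≤ n)
    (hl : 2 * (n : ℝ) - 2 * t - 2 < l) (hroot : quotientPoly n t l = 0) :
    l ≤ signlessRadius (extremalGraph n t) := by
  classical
  have htR : (1 : ℝ) ≤ t := by exact_mod_cast ht
  have hnR : 7 * (t : ℝ) + 1 ≤ n := by exact_mod_cast hn
  have hsub : ((n - 2 * t : ℕ) : ℝ) = n - 2 * t := by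
    rw [Nat.cast_sub (by omega)]
    push_cast
    rfl
  have hC : 0 < l - 2 * n + 3 * t + 2 := by linarith
  have hB : 0 < l - t := by linarith
  set b := (t : ℝ) / (l - 2 * n + 3 * t + 2) with hb
  set c := (t : ℝ) / (l - t) with hc
  have hbe : b * (l - 2 * n + 3 * t + 2) = t := div_mul_cancel₀ _ hC.ne'
  have hce : c * (l - t) = t := div_mul_cancel₀ _ hB.ne'
  -- The cubic is the defect of the join-vertex row times two nonzero factors, so at a root `(1, b,
  -- c)` satisfies all three rows.
  have hS : n + t - 2 + (n - 2 * t) * b + t * c = l := by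
    have : quotientPoly n t l =
        (l - (n + t - 2 + (n - 2 * t) * b + t * c)) * ((l - t) * (l - 2 * n + 3 * t + 2)) := by
      unfold quotientPoly
      linear_combination (n - 2 * t) * (l - t) * hbe + t * (l - 2 * n + 3 * t + 2) * hce
    rw [this, mul_eq_zero] at hroot
    rcases hroot with h | h
    · linarith
    · exact absurd h (by positivity)
  have hsum_ne : ∀ (m : ℕ) (v : Fin m) (a : ℝ),
      (∑ u, if v ≠ u then a else 0) = m * a - a := by
    intro m v a
    rw [eq_sub_iff_add_eq, ← Finset.sum_filter, Finset.filter_ne, Finset.sum_erase_add _ _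
      (Finset.mem_univ v), Finset.sum_const, Finset.card_univ, Fintype.card_fin, nsmul_eq_mul]
  refine le_signlessRadius
    (x := Sum.elim (fun _ => (1 : ℝ)) (Sum.elim (fun _ => b) (fun _ => c))) ?_ ?_
  · intro h
    simpa using congrFun h (Sum.inl ⟨0, ht⟩)
  · ext v
    rw [signlessLaplacian_mulVec_apply_eq_sum_ite, Pi.smul_apply, smul_eq_mul]
    simp only [Fintype.sum_sum_type]
    rcases v with v | v | v
    · simp only [extremalGraph, join, SimpleGraph.sup_adj, SimpleGraph.sum_adj,
        SimpleGraph.top_adj, completeBipartiteGraph_adj, Sum.isLeft_inl, Sum.isRight_inl,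
        Sum.isRight_inr, Sum.elim_inl, Sum.elim_inr, Bool.false_eq_true, and_false, and_true,
        or_false, or_true, false_and, if_true, hsum_ne, Finset.sum_const, Finset.card_univ,
        Fintype.card_fin, nsmul_eq_mul, hsub]
      linarith
    · simp only [extremalGraph, join, SimpleGraph.sup_adj, SimpleGraph.sum_adj,
        SimpleGraph.top_adj, completeBipartiteGraph_adj, Sum.isLeft_inl,
        Sum.isLeft_inr, Sum.isRight_inl, Sum.isRight_inr, Sum.elim_inl, Sum.elim_inr,
        Bool.false_eq_true, and_false, and_true, or_false, or_true, if_true, if_false,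
        hsum_ne, Finset.sum_const, Finset.card_univ, Fintype.card_fin, nsmul_eq_mul, hsub]
      linarith
    · simp only [extremalGraph, join, SimpleGraph.sup_adj, SimpleGraph.sum_adj,
        SimpleGraph.bot_adj, completeBipartiteGraph_adj, Sum.isLeft_inl,
        Sum.isLeft_inr, Sum.isRight_inl, Sum.isRight_inr, Sum.elim_inl, Sum.elim_inr,
        Bool.false_eq_true, and_false, and_true, or_false, or_true, if_true, if_false,
        Finset.sum_const, Finset.card_univ, Fintype.card_fin, nsmul_eq_mul]
      linarith

end LeafDist

theorem theorem1p9 {V : Type*} [Fintype V] (G : SimpleGraph V) [DecidableRel G.Adj] (t : ℕ)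
    (ht : 1 ≤ t) (hconn : G.Connected) (hn : 7 * t + 1 ≤ Fintype.card V) (hδ : t ≤ G.minDegree)
    (hq : LeafDist.signlessRadius (LeafDist.extremalGraph (Fintype.card V) t) ≤
      LeafDist.signlessRadius G) :
    ∃ T : SimpleGraph V, LeafDist.IsSpanningTree G T ∧ 4 ≤ LeafDist.leafDistance T := by
  have hne : Nonempty V := hconn.nonempty
  by_cases hpath : ∃ p, LeafDist.IsHamPath G p
  · obtain ⟨p, hp⟩ := hpath
    exact hp.exists_isSpanningTree (by omega)
  · exfalso
    push Not at hpath
    obtain ⟨k, hk, hlow, hhigh⟩ :=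
      LeafDist.exists_card_degree_le_of_forall_not_isHamPath hpath
    have htk : t ≤ k := by
      obtain ⟨v, hv⟩ := Finset.card_pos.1 ((Nat.succ_pos k).trans_le hlow)
      have hv := (Finset.mem_filter.1 hv).2
      refine (hδ.trans (G.minDegree_le_degree v)).trans (le_of_eq_of_le ?_ hv)
      congr!
    obtain ⟨l, hl, hroot⟩ := LeafDist.exists_quotientPoly_eq_zero (n := Fintype.card V) (t := t)
      (by exact_mod_cast ht) (by exact_mod_cast hn)
    have h1 := LeafDist.le_signlessRadius_extremalGraph ht hn hl hroot
    have h2 := LeafDist.signlessRadius_lt_of_card_degree_le ht hn hl hroot htk hk hlow hhigh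
    linarith
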